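/- A zroupoid is an algebra $\mathbf A=\langle A,\to,0\rangle$ with a binary operation $\to$ and a constant $0$; put $x':=x\to 0$ and $x\wedge y:=(x\to y')'$. Let $\mathcal I$ be the variety of implication zroupoids, i.e. the zroupoids satisfying $(x\to y)\to z\approx((z'\to x)\to(y\to z)')'$ and $0''\approx 0$. Let $\mathcal S$ be the subvariety of $\mathcal I$ defined by $x''\approx x$ and $x\wedge y\approx y\wedge x$ (symmetric implication zroupoids), $\mathcal{SL}$ the subvariety of $\mathcal I$ defined by $x'\approx x$ and $x\to y\approx y\to x$, and $\mathcal{BA}$ the subvariety of $\mathcal I$ defined by $(x\to y)\to x\approx x$ and $x\to x\approx 0'$. A weak associative law of length $n$ is an identity $p\approx q$ between two terms built from variables by $\to$ alone, each with $n$ occurrences of variables, in which the same variables occur in the same order (only the bracketing may differ). Let $43\mathcal A12$, $43\mathcal A23$, $42\mathcal A12$, $43\mathcal F25$ be the subvarieties of $\mathcal S$ defined respectively by $$x\to(x\to(y\to z))\approx x\to((x\to y)\to z),\qquad x\to((x\to y)\to z)\approx(x\to x)\to(y\to z),$$ $$x\to(x\to(x\to y))\approx x\to((x\to x)\to y),\qquad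 x\to((y\to z)\to z)\approx((x\to y)\to z)\to z.$$ Theorem 8.2. (a) Up to renaming of variables and interchange of the two sides, there are exactly $155$ weak associative laws $p\approx q$ of length $\le 4$ with $p\neq q$. The subvarieties of $\mathcal S$ defined by a single one of these laws are exactly $$\mathcal{SL},\quad 43\mathcal A12,\quad 43\mathcal A23,\quad 42\mathcal A12,\quad 43\mathcal F25,\quad \mathcal S,$$ and these six varieties are pairwise distinct. The same six varieties are obtained from all weak associative laws of length $\le 4$, trivial ones included. (b) With $\subset$ denoting proper inclusion, 1. $\mathcal{SL}\subset 43\mathcal A23\subset 43\mathcal F25\subset\mathcal S$; 2. $\mathcal{SL}\subset 43\mathcal A12\subset 42\mathcal A12\subset\mathcal S$; 3. $\mathcal{BA}\subset 43\mathcal A12\subset 43\mathcal F25$; 4. $43\mathcal A12\not\subseteq 43\mathcal A23$ and $43\mathcal A23\not\subseteq 43\mathcal A12$; 5. $42\mathcal A12\not\subseteq 43\mathcal F25$ and $43\mathcal F25\not\subseteq 42\mathcal A12$. Each of the four non-inclusions in 4 and 5 is witnessed by a finite algebra. -/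

import Mathlib

universe u

/-- A zroupoid: an algebra with one binary operation `imp` and one constant `zero`. -/
structure Zroupoid : Type (u + 1) where
  carrier : Type u
  imp : carrier → carrier → carrier
  zero : carrier

namespace Zroupoid

/-- The derived unary operation `x' := x → 0`. -/
def neg (A : Zroupoid.{u}) (x : A.carrier) : A.carrier := A.imp x A.zero

/-- The derived operation `x ∧ y := (x → y')'`. -/
def meet (A : Zroupoid.{u}) (x y : A.carrier) : A.carrier := A.neg (A.imp x (A.neg y))

/-- The variety `𝓘` of implication zroupoids:
`(x → y) → z ≈ ((z' → x) → (y → z)')'` and `0'' ≈ 0`. -/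
def varI : Set Zroupoid.{u} :=
  {A | (∀ x y z : A.carrier, A.imp (A.imp x y) z =
        A.neg (A.imp (A.imp (A.neg z) x) (A.neg (A.imp y z)))) ∧
      A.neg (A.neg A.zero) = A.zero}

/-- The variety `𝓢` of symmetric implication zroupoids: the members of `𝓘` satisfying
`x'' ≈ x` and `x ∧ y ≈ y ∧ x`. -/
def varS : Set Zroupoid.{u} :=
  {A | A ∈ varI ∧ (∀ x : A.carrier, A.neg (A.neg x) = x) ∧
      ∀ x y : A.carrier, A.meet x y = A.meet y x}

/-- The variety `𝓢𝓛`: the members of `𝓘` satisfying `x' ≈ x` and `x → y ≈ y → x`. -/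
def varSL : Set Zroupoid.{u} :=
  {A | A ∈ varI ∧ (∀ x : A.carrier, A.neg x = x) ∧
      ∀ x y : A.carrier, A.imp x y = A.imp y x}

/-- The variety `𝓓𝓜`: the members of `𝓘` satisfying `(x → y) → x ≈ x`. -/
def varDM : Set Zroupoid.{u} :=
  {A | A ∈ varI ∧ ∀ x y : A.carrier, A.imp (A.imp x y) x = x}

/-- The variety `𝓑𝓐`: the members of `𝓓𝓜` satisfying `x → x ≈ 0'`. -/
def varBA : Set Zroupoid.{u} :=
  {A | A ∈ varDM ∧ ∀ x : A.carrier, A.imp x x = A.neg A.zero}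

/-! Groupoid terms over the variables `0, 1, 2, …` are the elements of `FreeMagma ℕ`;
the length of a term, `FreeMagma.length`, is its number of occurrences of variables. -/

/-- The word of a term: the list of its variables, from left to right, with repetitions. -/
def word : FreeMagma ℕ → List ℕ
  | FreeMagma.of n => [n]
  | FreeMagma.mul s t => word s ++ word t

/-- The value of a term in `A`, the binary operation symbol being read as `→`. -/
def eval (A : Zroupoid.{u}) (v : ℕ → A.carrier) : FreeMagma ℕ → A.carrier
  | FreeMagma.of n => v n
  | FreeMagma.mul s t => A.imp (A.eval v s) (A.eval v t)

/-- `A` satisfies the identity `p ≈ q`. -/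
def Satisfies (A : Zroupoid.{u}) (p q : FreeMagma ℕ) : Prop :=
  ∀ v : ℕ → A.carrier, A.eval v p = A.eval v q

/-- The subvariety of `𝓢` defined by the identity `p ≈ q`. -/
def subvariety (p q : FreeMagma ℕ) : Set Zroupoid.{u} :=
  {A | A ∈ varS ∧ A.Satisfies p q}

/-- `p ≈ q` is a weak associative law of length `n`: both terms have length `n`, and they
contain the same variables in the same order. -/
def IsWeakAssociativeLaw (n : ℕ) (p q : FreeMagma ℕ) : Prop :=
  p.length = n ∧ q.length = n ∧ word p = word q

/-- The variables occur alphabetically in the word `w`: before any occurrence of a variable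
every alphabetically earlier variable has already occurred. -/
def Alphabetical (w : List ℕ) : Prop :=
  ∀ (i : ℕ) (hi : i < w.length), ∀ k < w[i], k ∈ w.take i

/-- The nontrivial weak associative laws of length at most `4`, each listed once: the variables
are named in the order of their first occurrence, and `p ≈ q` is identified with `q ≈ p`. -/
def weakLaws : Set (Sym2 (FreeMagma ℕ)) :=
  {e | ∃ p q : FreeMagma ℕ, e = s(p, q) ∧ (∃ n ≤ 4, IsWeakAssociativeLaw n p q) ∧
      p ≠ q ∧ Alphabetical (word p)}

/-- The variables `x`, `y`, `z`. -/
abbrev x : FreeMagma ℕ := FreeMagma.of 0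
abbrev y : FreeMagma ℕ := FreeMagma.of 1
abbrev z : FreeMagma ℕ := FreeMagma.of 2

/-- `x → (x → (y → z)) ≈ x → ((x → y) → z)` -/
def var43A12 : Set Zroupoid.{u} := subvariety (x * (x * (y * z))) (x * ((x * y) * z))

/-- `x → ((x → y) → z) ≈ (x → x) → (y → z)` -/
def var43A23 : Set Zroupoid.{u} := subvariety (x * ((x * y) * z)) ((x * x) * (y * z))

/-- `x → (x → (x → y)) ≈ x → ((x → x) → y)` -/
def var42A12 : Set Zroupoid.{u} := subvariety (x * (x * (x * y))) (x * ((x * x) * y))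

/-- `x → ((y → z) → z) ≈ ((x → y) → z) → z` -/
def var43F25 : Set Zroupoid.{u} := subvariety (x * ((y * z) * z)) (((x * y) * z) * z)

/-- The six varieties. -/
def sixVarieties : Set (Set Zroupoid.{u}) :=
  {varSL, var43A12, var43A23, var42A12, var43F25, varS}

end Zroupoid

/-!
With `x ∨ y := x' → y`, the axioms of `𝓢` say that `∨` and `∧` are commutative, have the units `0` and
`1 := 0'`, distribute over each other, and are exchanged by the involution `'`
(`Zroupoid.toBidistributive`). Such a pair of operations is the structure of a distributive
bisemilattice: the map `ε x := 0 ∧ x` sends both operations to one semilattice operation, and its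
fibres are bounded distributive lattices (`Bidistributive.Fibre`), connected by the projections
`x ↦ x ∨ ε y`. The involution permutes the fibres. Hence, by the prime ideal theorem, two elements
are equal once they lie in the same fibre and all `Bool`-valued characters of that fibre agree on
them (`Bidistributive.eq_of_forall_isCharacter`), and the value of a term at a character is computed
from independent truth values for each variable and for its negation.

Three properties of `A ∈ 𝓢` matter: each `x'` lies in the fibre of `x` (`NegBelow`), `x ∨ x'` is the
greatest element of its fibre (`Complemented`), and `0 = 1`, that is, all fibres are singletons
(`Flat`). An identity that fails in the four-element semilattice with a swap forces `NegBelow`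
(`negBelow_of_satisfies`), one that fails in the two-element Boolean algebra forces `Flat`
(`flat_of_satisfies`), and one that fails in the three-element Kleene algebra forces `Complemented`
(`complemented_of_satisfies`). Conversely the forced properties suffice for the identity, provided
that its validity in the Kleene algebra implies validity in the four-element De Morgan algebra
(`satisfies_of_valid`); for terms of length at most four this is a finite check
(`KleeneValid.deMorganFour`). So every law defines a conjunction of these properties, and as `Flat`
implies `Complemented` there are six conjunctions, all of which occur:
`𝓢𝓛` is `NegBelow ∧ Flat`, `43𝓐12` is `NegBelow ∧ Complemented`, `43𝓐23` is `Flat`, `42𝓐12` is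
`NegBelow`, and `43𝓕25` is `Complemented`. The inclusions are then immediate, and the finite algebras
above separate the varieties.
-/

/-! ### Distributive bisemilattices with units -/

/-- Two commutative operations with units, each distributing over the other. Neither associativity
nor idempotency is assumed; idempotency is `join_self`, and associativity within each fibre of
`eps` is `join_assoc_of_eps_eq`. -/
structure Bidistributive (α : Type u) where
  join : α → α → α
  meet : α → α → α
  bot : α
  top : α
  join_comm : ∀ x y, join x y = join y x
  meet_comm : ∀ x y, meet x y = meet y x
  join_bot : ∀ x, join x bot = x
  meet_top : ∀ x, meet x top = x
  meet_join : ∀ x y z, meet (join x y) z = join (meet x z) (meet y z)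
  join_meet : ∀ x y z, join (meet x y) z = meet (join x z) (join y z)

namespace Bidistributive

variable {α : Type u} (T : Bidistributive α)

/-- The structure with the two operations and the two units exchanged. -/
def dual : Bidistributive α where
  join := T.meet
  meet := T.join
  bot := T.top
  top := T.bot
  join_comm := T.meet_comm
  meet_comm := T.join_comm
  join_bot := T.meet_top
  meet_top := T.join_bot
  meet_join := T.join_meet
  join_meet := T.meet_join

/-- The least element `0 ∧ x` of the fibre of `x`. -/
def eps (x : α) : α := T.meet T.bot x

/-- The greatest element `1 ∨ x` of the fibre of `x`. -/
def eta (x : α) : α := T.join T.top x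

/-- The projection of `x` to the fibre of `x ∨ y`. -/
def proj (x y : α) : α := T.join x (T.eps y)

lemma bot_join (x : α) : T.join T.bot x = x := by rw [T.join_comm, T.join_bot]

lemma top_meet (x : α) : T.meet T.top x = x := T.dual.bot_join x

lemma join_eps_self (x : α) : T.join x (T.eps x) = x := by
  have h : T.meet (T.join T.bot T.top) x = T.meet T.top x := by rw [T.bot_join]
  rw [T.meet_join, T.top_meet, T.join_comm] at h
  exact h

lemma join_top_top : T.join T.top T.top = T.top := by
  have h := T.dual.join_eps_self T.top
  change T.meet T.top (T.join T.top T.top) = T.top at h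
  rwa [T.top_meet] at h

lemma join_self (x : α) : T.join x x = x := by
  have h := T.meet_join T.top T.top x
  rw [T.join_top_top, T.top_meet] at h
  exact h.symm

lemma meet_self (x : α) : T.meet x x = x := T.dual.join_self x

lemma join_eps (x y : α) : T.join (T.eps x) (T.eps y) = T.eps (T.join x y) := by
  simp only [eps]
  rw [T.meet_comm _ x, T.meet_comm _ y, ← T.meet_join, T.meet_comm]

lemma meet_eta (x y : α) : T.meet (T.eta x) (T.eta y) = T.eta (T.meet x y) := T.dual.join_eps x y

lemma proj_eq_meet_join (x y : α) : T.proj x y = T.meet x (T.join x y) := by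
  rw [proj, eps, T.join_comm, T.join_meet, T.bot_join, T.join_comm y]

lemma proj_eq_join_meet (x y : α) : T.proj x y = T.join x (T.meet x y) := by
  rw [proj_eq_meet_join, T.meet_comm, T.meet_join, T.meet_self, T.meet_comm y]

lemma proj_eq_meet_eta (x y : α) : T.proj x y = T.meet x (T.eta y) := by
  rw [proj_eq_join_meet]
  exact (T.dual.proj_eq_meet_join x y).symm

lemma eps_eta (x : α) : T.eps (T.eta x) = T.eps x := by
  have h := T.proj_eq_meet_eta T.bot x
  rw [proj, T.bot_join] at h
  exact h.symm

lemma eta_eps (x : α) : T.eta (T.eps x) = T.eta x := T.dual.eps_eta x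

lemma eps_eps (x : α) : T.eps (T.eps x) = T.eps x := by
  rw [← T.eps_eta (T.eps x), T.eta_eps, T.eps_eta]

lemma proj_eta (x y : α) : T.proj x (T.eta y) = T.proj x y := by
  rw [proj, T.eps_eta, proj]

lemma join_eta_meet (x y : α) :
    T.join (T.eta x) (T.meet (T.eta x) (T.eta y)) = T.meet (T.eta x) (T.eta y) := by
  rw [← T.proj_eq_join_meet, T.proj_eta, T.proj_eq_meet_eta]

/-- On the greatest elements of the fibres the two operations agree. -/
lemma join_eta_eq_meet_eta (x y : α) :
    T.join (T.eta x) (T.eta y) = T.meet (T.eta x) (T.eta y) := by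
  have key : ∀ a b, T.meet (T.eta a) (T.join (T.eta a) (T.eta b)) = T.meet (T.eta a) (T.eta b) :=
    fun a b => by rw [← T.proj_eq_meet_join, T.proj_eta, T.proj_eq_meet_eta]
  rw [← T.meet_self (T.join (T.eta x) (T.eta y)), T.meet_join, key, T.join_comm (T.eta x), key,
    T.meet_comm (T.eta y), T.join_self]

lemma meet_eps_eq_join_eps (x y : α) :
    T.meet (T.eps x) (T.eps y) = T.join (T.eps x) (T.eps y) := T.dual.join_eta_eq_meet_eta x y

lemma eps_meet (x y : α) : T.eps (T.meet x y) = T.eps (T.join x y) := by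
  rw [← T.eps_eta, ← T.meet_eta, ← T.join_eta_eq_meet_eta, ← T.join_eps, T.eps_eta, T.eps_eta,
    T.join_eps]

lemma join_eps_left (x y : α) : T.join (T.eps x) (T.eps (T.join x y)) = T.eps (T.join x y) := by
  have h := T.dual.join_eta_meet x y
  change T.meet (T.eps x) (T.join (T.eps x) (T.eps y)) = T.join (T.eps x) (T.eps y) at h
  rwa [T.join_eps, T.meet_eps_eq_join_eps] at h

lemma proj_join (x y w : α) : T.proj (T.join x y) w = T.join (T.proj x w) (T.proj y w) := by
  simp only [T.proj_eq_meet_eta, T.meet_join]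

lemma proj_meet (x y w : α) : T.proj (T.meet x y) w = T.meet (T.proj x w) (T.proj y w) := by
  simp only [proj, T.join_meet]

lemma proj_proj (x y w : α) : T.proj (T.proj x y) w = T.proj (T.proj x w) (T.join y w) := by
  rw [show T.proj x y = T.join x (T.eps y) from rfl, proj_join,
    show T.proj (T.eps y) w = T.join (T.eps y) (T.eps w) from rfl, T.join_eps]
  rfl

lemma join_eps_right_distrib (x y w : α) :
    T.join (T.eps (T.join x y)) (T.eps w) =
      T.join (T.eps (T.join x w)) (T.eps (T.join y w)) := by
  have h := T.proj_proj (T.eps x) y w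
  simpa only [proj, T.join_eps] using h

/-- The least elements of the fibres form a semilattice. -/
lemma eps_join_assoc (x y w : α) :
    T.eps (T.join (T.join x y) w) = T.eps (T.join x (T.join y w)) := by
  have swap : ∀ a b c, T.join (T.eps (T.join a b)) (T.eps c) =
      T.join (T.eps (T.join a c)) (T.eps b) := fun a b c => by
    rw [T.join_eps_right_distrib, T.join_comm (T.eps (T.join a c)), T.join_eps_right_distrib,
      ← T.join_eps c, T.join_comm a c, T.join_eps_left, T.join_comm b, T.join_comm,
      T.join_eps_left, T.join_eps]
  rw [← T.join_eps, T.join_comm x y, swap, T.join_comm, T.join_eps, T.join_comm y w]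

/-- `x` lies in a fibre below the fibre of `y`. -/
def Below (x y : α) : Prop := T.eps (T.join x y) = T.eps y

lemma below_of_eps_eq {x y : α} (h : T.eps x = T.eps y) : T.Below x y := by
  rw [Below, ← T.join_eps, h, T.join_self]

lemma below_refl (x : α) : T.Below x x := T.below_of_eps_eq rfl

lemma eps_eq_of_below {x y : α} (h : T.Below x y) (h' : T.Below y x) : T.eps x = T.eps y := by
  rw [← h', T.join_comm, h]

lemma Below.trans {x y w : α} (h : T.Below x y) (h' : T.Below y w) : T.Below x w := by
  rw [Below, ← T.join_eps, ← h', T.join_eps, ← T.eps_join_assoc, ← T.join_eps, h, T.join_eps]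

lemma below_join_left (x y : α) : T.Below x (T.join x y) := by
  rw [Below, ← T.join_eps, T.join_eps_left]

lemma join_below_iff {x y w : α} : T.Below (T.join x y) w ↔ T.Below x w ∧ T.Below y w := by
  refine ⟨fun h => ⟨(T.below_join_left x y).trans T h,
    (T.join_comm x y ▸ T.below_join_left y x).trans T h⟩, fun h => ?_⟩
  rw [Below, T.eps_join_assoc, ← T.join_eps, h.2, T.join_eps, h.1]

lemma meet_below_iff {x y w : α} : T.Below (T.meet x y) w ↔ T.Below x w ∧ T.Below y w := by
  rw [← join_below_iff, Below, Below, ← T.join_eps, T.eps_meet, T.join_eps]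

lemma bot_below (x : α) : T.Below T.bot x := by rw [Below, T.bot_join]

lemma top_below (x : α) : T.Below T.top x := T.eps_eta x

lemma eps_proj_of_below {x e : α} (h : T.Below x e) : T.eps (T.proj x e) = T.eps e := by
  rw [proj, ← T.join_eps, T.eps_eps, T.join_eps, h]

lemma proj_of_eps_eq {x e : α} (h : T.eps x = T.eps e) : T.proj x e = x := by
  rw [proj, ← h, T.join_eps_self]

lemma proj_bot (e : α) : T.proj T.bot e = T.eps e := T.bot_join _

lemma proj_top (e : α) : T.proj T.top e = T.eta e := by rw [proj_eq_meet_eta, T.top_meet]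

lemma eta_join (x : α) : T.join (T.eta x) x = T.eta x := by
  have h : T.meet x (T.eta x) = x := T.dual.join_eps_self x
  have h' := T.proj_of_eps_eq (T.eps_eta x)
  rwa [proj_eq_join_meet, T.meet_comm, h] at h'

/-! ### The fibres are distributive lattices -/

/-- Within a fibre of `eps` the absorption law holds. -/
lemma meet_join_cancel {x y : α} (h : T.eps x = T.eps y) : T.meet x (T.join x y) = x := by
  rw [← T.proj_eq_meet_join, T.proj_of_eps_eq h]

lemma join_assoc_of_eps_eq {x y w : α} (hxy : T.eps x = T.eps y) (hyw : T.eps y = T.eps w) :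
    T.join (T.join x y) w = T.join x (T.join y w) := by
  have e1 : ∀ {a b : α}, T.eps a = T.eps w → T.eps b = T.eps w → T.eps (T.join a b) = T.eps w :=
    fun ha hb => by rw [← T.join_eps, ha, hb, T.join_self]
  have hx := hxy.trans hyw
  -- each of three elements of the fibre absorbs both of their bracketed joins
  have l1 : ∀ {a b c : α}, T.eps a = T.eps w → T.eps b = T.eps w → T.eps c = T.eps w →
      T.meet a (T.join (T.join a b) c) = a := fun {a b c} ha hb hc => by
    rw [T.meet_comm, T.meet_join, T.meet_comm _ a, T.meet_join_cancel (ha.trans hb.symm),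
      T.meet_comm, ← T.proj_eq_join_meet, T.proj_of_eps_eq (ha.trans hc.symm)]
  have l2 : ∀ {a b c : α}, T.eps a = T.eps w → T.eps b = T.eps w → T.eps c = T.eps w →
      T.meet a (T.join b (T.join a c)) = a := fun {a b c} ha hb hc => by
    rw [T.join_comm b, T.join_comm a, T.join_comm c, l1 ha hc hb]
  have l3 : ∀ {a b : α}, T.eps a = T.eps w → T.eps b = T.eps w →
      T.meet a (T.join a b) = a := fun ha hb => T.meet_join_cancel (ha.trans hb.symm)
  set a := T.join (T.join x y) w with ha
  set b := T.join x (T.join y w) with hb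
  have xa : T.meet x a = x := l1 hx hyw rfl
  have ya : T.meet y a = y := by rw [ha, T.join_comm x y]; exact l1 hyw hx rfl
  have wa : T.meet w a = w := by rw [ha, T.join_comm]; exact l3 rfl (e1 hx hyw)
  have xb : T.meet x b = x := l3 hx (e1 hyw rfl)
  have yb : T.meet y b = y := l2 hyw hx rfl
  have wb : T.meet w b = w := by rw [hb, T.join_comm y]; exact l2 rfl hx hyw
  have hab : T.meet a b = a := by
    conv_lhs => rw [ha, T.meet_join, T.meet_join, xb, yb, wb]
  have hba : T.meet b a = b := by
    conv_lhs => rw [hb, T.meet_join, T.meet_join, xa, ya, wa]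
  rw [← hab, T.meet_comm, hba]

lemma meet_assoc_of_eps_eq {x y w : α} (hxy : T.eps x = T.eps y) (hyw : T.eps y = T.eps w) :
    T.meet (T.meet x y) w = T.meet x (T.meet y w) := by
  refine T.dual.join_assoc_of_eps_eq ?_ ?_
  · change T.eta x = T.eta y
    rw [← T.eta_eps, hxy, T.eta_eps]
  · change T.eta y = T.eta w
    rw [← T.eta_eps, hyw, T.eta_eps]

/-- The fibre of `e`: the elements with the same least fibre element as `e`. -/
def Fibre (e : α) : Type u := {x : α // T.eps x = T.eps e}

variable {T} in
/-- The projection of an element below `e` to the fibre of `e`. -/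
def Below.toFibre {a e : α} (h : T.Below a e) : T.Fibre e := ⟨T.proj a e, T.eps_proj_of_below h⟩

instance (e : α) : DistribLattice (T.Fibre e) :=
  letI : Max (T.Fibre e) := ⟨fun a b => ⟨T.join a.1 b.1, by
    rw [← T.join_eps, a.2, b.2, T.join_self]⟩⟩
  letI : Min (T.Fibre e) := ⟨fun a b => ⟨T.meet a.1 b.1, by
    rw [T.eps_meet, ← T.join_eps, a.2, b.2, T.join_self]⟩⟩
  letI : Lattice (T.Fibre e) := Lattice.mk'
    (fun a b => Subtype.ext (T.join_comm a.1 b.1))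
    (fun a b c => Subtype.ext (T.join_assoc_of_eps_eq (a.2.trans b.2.symm) (b.2.trans c.2.symm)))
    (fun a b => Subtype.ext (T.meet_comm a.1 b.1))
    (fun a b c => Subtype.ext (T.meet_assoc_of_eps_eq (a.2.trans b.2.symm) (b.2.trans c.2.symm)))
    (fun a b => Subtype.ext (by
      change T.join a.1 (T.meet a.1 b.1) = a.1
      rw [← T.proj_eq_join_meet, T.proj_of_eps_eq (a.2.trans b.2.symm)]))
    (fun a b => Subtype.ext (T.meet_join_cancel (a.2.trans b.2.symm)))
  DistribLattice.ofInfSupLe fun a b c => le_of_eq (Subtype.ext (by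
    change T.meet a.1 (T.join b.1 c.1) = T.join (T.meet a.1 b.1) (T.meet a.1 c.1)
    rw [T.meet_comm, T.meet_join, T.meet_comm b.1, T.meet_comm c.1]))

/-- A bounded lattice homomorphism from the fibre of `e` to `Bool`, seen as a function on the
elements below `e`, which are first projected to that fibre. Other values are irrelevant. -/
structure IsCharacter (e : α) (f : α → Bool) : Prop where
  map_join : ∀ a b, T.Below a e → T.Below b e → f (T.join a b) = (f a || f b)
  map_meet : ∀ a b, T.Below a e → T.Below b e → f (T.meet a b) = (f a && f b)
  map_bot : f T.bot = false
  map_top : f T.top = true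

/-- A prime ideal of the fibre of `e` separates `x` from `y` unless `x ≤ y`. -/
lemma exists_isCharacter_of_join_ne {e x y : α} (hx : T.eps x = T.eps e) (hy : T.eps y = T.eps e)
    (h : T.join x y ≠ y) : ∃ f, T.IsCharacter e f ∧ f x = true ∧ f y = false := by
  classical
  let X : T.Fibre e := ⟨x, hx⟩
  let Y : T.Fibre e := ⟨y, hy⟩
  have hXY : ¬ X ≤ Y := fun hle => h (by
    have hXY : X ⊔ Y = Y := sup_eq_right.2 hle
    exact congrArg Subtype.val hXY)
  obtain ⟨J, hJ, hYJ, hd⟩ := DistribLattice.prime_ideal_of_disjoint_filter_ideal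
    (F := Order.PFilter.principal X) (I := Order.Ideal.principal Y) (by
      rw [Set.disjoint_left]
      exact fun a ha hb => hXY ((Order.PFilter.mem_principal.1 ha).trans
        (Order.Ideal.mem_principal.1 hb)))
  have hXJ : X ∉ J := fun hm =>
    Set.disjoint_left.1 hd (Order.PFilter.mem_principal.2 le_rfl) hm
  have hYJ' : Y ∈ J := hYJ (Order.Ideal.mem_principal.2 le_rfl)
  let f : α → Bool := fun a => decide (∃ h : T.Below a e, h.toFibre ∉ J)
  have hf : ∀ {a} (h : T.Below a e), f a = decide (h.toFibre ∉ J) := fun h =>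
    decide_eq_decide.2 ⟨fun ⟨_, h'⟩ => h', fun h' => ⟨h, h'⟩⟩
  have hfix : ∀ A : T.Fibre e, f A.1 = decide (A ∉ J) := fun A => by
    have hA : (T.below_of_eps_eq A.2).toFibre = A := Subtype.ext (T.proj_of_eps_eq A.2)
    rw [hf (T.below_of_eps_eq A.2), hA]
  refine ⟨f, ⟨fun a b ha hb => ?_, fun a b ha hb => ?_, ?_, ?_⟩, ?_, ?_⟩
  · have hab := T.join_below_iff.2 ⟨ha, hb⟩
    have h1 : hab.toFibre = ha.toFibre ⊔ hb.toFibre := Subtype.ext (T.proj_join a b e)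
    rw [hf hab, hf ha, hf hb, ← Bool.decide_or]
    refine decide_eq_decide.2 ?_
    rw [h1, Order.Ideal.sup_mem_iff]
    exact not_and_or
  · have hab := T.meet_below_iff.2 ⟨ha, hb⟩
    have h1 : hab.toFibre = ha.toFibre ⊓ hb.toFibre := Subtype.ext (T.proj_meet a b e)
    rw [hf hab, hf ha, hf hb, ← Bool.decide_and]
    refine decide_eq_decide.2 ?_
    rw [h1]
    exact ⟨fun hm => ⟨fun h1 => hm (J.lower inf_le_left h1),
      fun h1 => hm (J.lower inf_le_right h1)⟩, fun hm h1 => (hJ.mem_or_mem h1).elim hm.1 hm.2⟩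
  · rw [hf (T.bot_below e), decide_eq_false_iff_not, not_not]
    refine J.lower (sup_eq_right.1 (Subtype.ext ?_)) hYJ'
    change T.join (T.proj T.bot e) y = y
    rw [T.proj_bot, ← hy, T.join_comm, T.join_eps_self]
  · rw [hf (T.top_below e), decide_eq_true_iff]
    refine fun hm => hXJ (J.lower (inf_eq_left.1 (Subtype.ext ?_)) hm)
    change T.meet x (T.proj T.top e) = x
    rw [T.proj_top, ← T.proj_eq_meet_eta, T.proj_of_eps_eq hx]
  · exact (hfix X).trans (decide_eq_true hXJ)
  · exact (hfix Y).trans (decide_eq_false (not_not.2 hYJ'))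

/-- Elements of one fibre are separated by the characters of that fibre. -/
lemma eq_of_forall_isCharacter {x y : α} (h : T.eps x = T.eps y)
    (hf : ∀ f, T.IsCharacter x f → f x = f y) : x = y := by
  by_contra hne
  have h1 : T.join x y = y := by
    by_contra hn
    obtain ⟨f, hc, hx, hy⟩ := T.exists_isCharacter_of_join_ne rfl h.symm hn
    exact absurd (hf f hc) (by rw [hx, hy]; decide)
  have h2 : T.join y x = x := by
    by_contra hn
    obtain ⟨f, hc, hy, hx⟩ := T.exists_isCharacter_of_join_ne h.symm rfl hn
    exact absurd (hf f hc) (by rw [hx, hy]; decide)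
  exact hne (by rw [← h2, T.join_comm, h1])

end Bidistributive

/-! ### Symmetric implication zroupoids as distributive bisemilattices -/

namespace Zroupoid

variable {A : Zroupoid.{u}}

/-- The operation `x ∨ y := x' → y`. -/
def join (A : Zroupoid.{u}) (x y : A.carrier) : A.carrier := A.imp (A.neg x) y

lemma neg_neg_of_mem (hA : A ∈ varS) (x : A.carrier) : A.neg (A.neg x) = x := hA.2.1 x

lemma imp_eq_join (hA : A ∈ varS) (x y : A.carrier) : A.imp x y = A.join (A.neg x) y := by
  rw [join, neg_neg_of_mem hA]

lemma neg_join (hA : A ∈ varS) (x y : A.carrier) :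
    A.neg (A.join x y) = A.meet (A.neg x) (A.neg y) := by
  rw [meet, neg_neg_of_mem hA, join]

lemma neg_meet (hA : A ∈ varS) (x y : A.carrier) :
    A.neg (A.meet x y) = A.join (A.neg x) (A.neg y) := by
  rw [meet, neg_neg_of_mem hA, imp_eq_join hA]

lemma neg_imp (hA : A ∈ varS) (x y : A.carrier) : A.neg (A.imp x y) = A.meet x (A.neg y) := by
  rw [meet, neg_neg_of_mem hA]

lemma neg_injective (hA : A ∈ varS) : Function.Injective A.neg :=
  Function.LeftInverse.injective (neg_neg_of_mem hA)

/-- In presence of involutivity and commutativity of `∧`, the defining identity of `𝓘` says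
that `∨` distributes over `∧`. -/
lemma join_meet_of_mem (hA : A ∈ varS) (x y z : A.carrier) :
    A.join (A.meet x y) z = A.meet (A.join z x) (A.join y z) := by
  have h := hA.1.1 x (A.neg y) z
  rw [meet, join, neg_neg_of_mem hA, h, meet]
  rfl

lemma join_comm_of_mem (hA : A ∈ varS) (x y : A.carrier) : A.join x y = A.join y x :=
  neg_injective hA (by rw [neg_join hA, neg_join hA, hA.2.2])

/-- The distributive bisemilattice underlying a symmetric implication zroupoid. -/
def toBidistributive (hA : A ∈ varS) : Bidistributive A.carrier where
  join := A.join
  meet := A.meet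
  bot := A.zero
  top := A.neg A.zero
  join_comm := join_comm_of_mem hA
  meet_comm := hA.2.2
  join_bot x := neg_neg_of_mem hA x
  meet_top x := by rw [meet, neg_neg_of_mem hA]; exact neg_neg_of_mem hA x
  join_meet x y z := by rw [join_meet_of_mem hA, join_comm_of_mem hA z]
  meet_join x y z := neg_injective hA (by
    rw [neg_meet hA, neg_join hA, join_meet_of_mem hA, neg_join hA, neg_meet hA, neg_meet hA,
      join_comm_of_mem hA (A.neg z)])

/-- Every fibre is closed under `'`: equivalently, `x'` lies in a fibre below that of `x`. -/
def NegBelow (A : Zroupoid.{u}) : Prop :=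
  ∀ x : A.carrier, A.join (A.meet A.zero (A.neg x)) (A.meet A.zero x) = A.meet A.zero x

/-- `x ∨ x'` is the greatest element of its fibre. -/
def Complemented (A : Zroupoid.{u}) : Prop :=
  ∀ x : A.carrier, A.join x (A.neg x) = A.join (A.neg A.zero) (A.join x (A.neg x))

/-- `0` and `1` coincide: equivalently, every fibre is a singleton. -/
def Flat (A : Zroupoid.{u}) : Prop := A.neg A.zero = A.zero

lemma NegBelow.below (hA : A ∈ varS) (h : A.NegBelow) (x : A.carrier) :
    (toBidistributive hA).Below (A.neg x) x := by
  rw [Bidistributive.Below, ← Bidistributive.join_eps]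
  exact h x

lemma NegBelow.below_iff (hA : A ∈ varS) (h : A.NegBelow) {x e : A.carrier} :
    (toBidistributive hA).Below (A.neg x) e ↔ (toBidistributive hA).Below x e := by
  refine ⟨fun hx => Bidistributive.Below.trans _ ?_ hx, (h.below hA x).trans _⟩
  have := h.below hA (A.neg x)
  rwa [neg_neg_of_mem hA] at this

lemma Flat.eps_eq (hA : A ∈ varS) (h : A.Flat) (x : A.carrier) :
    (toBidistributive hA).eps x = x := by
  change A.meet A.zero x = x
  rw [← h]
  exact (toBidistributive hA).top_meet x

lemma Flat.complemented (hA : A ∈ varS) (h : A.Flat) : A.Complemented := fun x => by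
  rw [h]
  exact ((toBidistributive hA).bot_join _).symm

/-! ### The finite algebras -/

/-- The two-element Boolean algebra. -/
abbrev boolTwo : Zroupoid.{0} := ⟨Bool, fun a b => !a || b, false⟩

/-- The two-element semilattice with `x' = x`. -/
abbrev semilatticeTwo : Zroupoid.{0} := ⟨Bool, fun a b => a || b, false⟩

/-- The four-element De Morgan algebra with two fixed points of `'`. Elements are pairs recording
the truth values of `x` and of `x'`, independently of each other. -/
abbrev deMorganFour : Zroupoid.{0} :=
  ⟨Bool × Bool, fun a b => (a.2 || b.1, a.1 && b.2), (false, true)⟩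

/-- The square of the two-element semilattice, with `'` exchanging the coordinates. -/
abbrev semilatticeFour : Zroupoid.{0} :=
  ⟨Bool × Bool, fun a b => (a.2 || b.1, a.1 || b.2), (false, false)⟩

/-- `p ≈ q` holds in the three-element Kleene algebra, the subalgebra of `deMorganFour` that
omits the fixed point `(1, 1)`. -/
def KleeneValid (p q : FreeMagma ℕ) : Prop :=
  ∀ w : ℕ → Bool × Bool, (∀ i, w i ≠ (true, true)) → deMorganFour.eval w p = deMorganFour.eval w q

lemma eval_deMorganFour_bool (b : ℕ → Bool) (t : FreeMagma ℕ) :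
    deMorganFour.eval (fun i => (b i, !b i)) t = (boolTwo.eval b t, !boolTwo.eval b t) := by
  induction t with
  | ih1 n => rfl
  | ih2 s t hs ht =>
    change deMorganFour.imp (deMorganFour.eval _ s) (deMorganFour.eval _ t) = _
    rw [hs, ht]
    change _ = ((!boolTwo.eval b s || boolTwo.eval b t), !(!boolTwo.eval b s || boolTwo.eval b t))
    simp

lemma KleeneValid.boolTwo {p q : FreeMagma ℕ} (h : KleeneValid p q) : boolTwo.Satisfies p q := by
  intro b
  have h1 := h (fun i => (b i, !b i)) (fun i => by cases b i <;> simp)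
  rw [eval_deMorganFour_bool, eval_deMorganFour_bool] at h1
  exact congrArg Prod.fst h1

/-! ### Evaluating terms in a fibre -/

/-- The truth value of a term at a character depends only on the truth values of the variables
and of their negations that lie below the fibre. -/
lemma character_eval (hA : A ∈ varS) {e : A.carrier} {f : A.carrier → Bool}
    (hf : (toBidistributive hA).IsCharacter e f) {v : ℕ → A.carrier} {w : ℕ → Bool × Bool}
    (h1 : ∀ i, (toBidistributive hA).Below (v i) e → f (v i) = (w i).1)
    (h2 : ∀ i, (toBidistributive hA).Below (A.neg (v i)) e → f (A.neg (v i)) = (w i).2)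
    (t : FreeMagma ℕ) :
    ((toBidistributive hA).Below (A.eval v t) e →
      f (A.eval v t) = (deMorganFour.eval w t).1) ∧
    ((toBidistributive hA).Below (A.neg (A.eval v t)) e →
      f (A.neg (A.eval v t)) = (deMorganFour.eval w t).2) := by
  induction t with
  | ih1 n => exact ⟨h1 n, h2 n⟩
  | ih2 s t hs ht =>
    constructor
    · intro hb
      change (toBidistributive hA).Below (A.imp (A.eval v s) (A.eval v t)) e at hb
      change f (A.imp (A.eval v s) (A.eval v t)) =
        ((deMorganFour.eval w s).2 || (deMorganFour.eval w t).1)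
      rw [imp_eq_join hA] at hb ⊢
      obtain ⟨b1, b2⟩ := (toBidistributive hA).join_below_iff.1 hb
      rw [← hs.2 b1, ← ht.1 b2]
      exact hf.map_join _ _ b1 b2
    · intro hb
      change (toBidistributive hA).Below (A.neg (A.imp (A.eval v s) (A.eval v t))) e at hb
      change f (A.neg (A.imp (A.eval v s) (A.eval v t))) =
        ((deMorganFour.eval w s).1 && (deMorganFour.eval w t).2)
      rw [neg_imp hA] at hb ⊢
      obtain ⟨b1, b2⟩ := (toBidistributive hA).meet_below_iff.1 hb
      rw [← hs.1 b1, ← ht.2 b2]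
      exact hf.map_meet _ _ b1 b2

/-- The fibres of a term and of its negation are computed in `semilatticeFour`. -/
lemma semilatticeFour_eval (hA : A ∈ varS) {e : A.carrier} {v : ℕ → A.carrier}
    {w : ℕ → Bool × Bool}
    (h1 : ∀ i, (w i).1 = false ↔ (toBidistributive hA).Below (v i) e)
    (h2 : ∀ i, (w i).2 = false ↔ (toBidistributive hA).Below (A.neg (v i)) e)
    (t : FreeMagma ℕ) :
    ((semilatticeFour.eval w t).1 = false ↔ (toBidistributive hA).Below (A.eval v t) e) ∧
    ((semilatticeFour.eval w t).2 = false ↔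
      (toBidistributive hA).Below (A.neg (A.eval v t)) e) := by
  induction t with
  | ih1 n => exact ⟨h1 n, h2 n⟩
  | ih2 s t hs ht =>
    constructor
    · change ((semilatticeFour.eval w s).2 || (semilatticeFour.eval w t).1) = false ↔
        (toBidistributive hA).Below (A.imp (A.eval v s) (A.eval v t)) e
      rw [Bool.or_eq_false_iff, hs.2, ht.1, imp_eq_join hA]
      exact (toBidistributive hA).join_below_iff.symm
    · change ((semilatticeFour.eval w s).1 || (semilatticeFour.eval w t).2) = false ↔
        (toBidistributive hA).Below (A.neg (A.imp (A.eval v s) (A.eval v t))) e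
      rw [Bool.or_eq_false_iff, hs.1, ht.2, neg_imp hA]
      exact (toBidistributive hA).meet_below_iff.symm

lemma NegBelow.eval_below_iff (hA : A ∈ varS) (h : A.NegBelow) {e : A.carrier}
    {v : ℕ → A.carrier} (t : FreeMagma ℕ) :
    (toBidistributive hA).Below (A.eval v t) e ↔
      ∀ n ∈ word t, (toBidistributive hA).Below (v n) e := by
  induction t with
  | ih1 n => simp [word, eval]
  | ih2 s t hs ht =>
    change (toBidistributive hA).Below (A.imp (A.eval v s) (A.eval v t)) e ↔ _
    rw [imp_eq_join hA]
    refine (toBidistributive hA).join_below_iff.trans ?_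
    rw [h.below_iff hA, hs, ht, show word (s * t) = word s ++ word t from rfl]
    simp only [List.mem_append, or_imp, forall_and]

lemma eval_below (hA : A ∈ varS) {e : A.carrier} {v : ℕ → A.carrier}
    (h : ∀ i, (toBidistributive hA).Below (v i) e ∧ (toBidistributive hA).Below (A.neg (v i)) e)
    (t : FreeMagma ℕ) :
    (toBidistributive hA).Below (A.eval v t) e ∧
      (toBidistributive hA).Below (A.neg (A.eval v t)) e := by
  induction t with
  | ih1 n => exact h n
  | ih2 s t hs ht =>
    change (toBidistributive hA).Below (A.imp (A.eval v s) (A.eval v t)) e ∧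
      (toBidistributive hA).Below (A.neg (A.imp (A.eval v s) (A.eval v t))) e
    rw [neg_imp hA, imp_eq_join hA]
    exact ⟨(toBidistributive hA).join_below_iff.2 ⟨hs.2, ht.1⟩,
      (toBidistributive hA).meet_below_iff.2 ⟨hs.1, ht.2⟩⟩

/-! ### When an identity holds -/

/-- Both sides of the identity take values in the same fibre. -/
lemma eps_eval_eq (hA : A ∈ varS) {p q : FreeMagma ℕ} (hw : word p = word q)
    (h : semilatticeFour.Satisfies p q ∨ A.NegBelow) (v : ℕ → A.carrier) :
    (toBidistributive hA).eps (A.eval v p) = (toBidistributive hA).eps (A.eval v q) := by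
  classical
  have key : ∀ e, (toBidistributive hA).Below (A.eval v p) e ↔
      (toBidistributive hA).Below (A.eval v q) e := by
    intro e
    rcases h with h | h
    · let w : ℕ → Bool × Bool := fun i =>
        (decide ¬ (toBidistributive hA).Below (v i) e,
          decide ¬ (toBidistributive hA).Below (A.neg (v i)) e)
      have h1 := fun t => (semilatticeFour_eval hA (v := v) (w := w) (e := e)
        (fun i => by simp [w]) (fun i => by simp [w]) t).1
      rw [← h1, ← h1, h w]
    · rw [h.eval_below_iff hA, h.eval_below_iff hA, hw]
  exact (toBidistributive hA).eps_eq_of_below ((key _).2 ((toBidistributive hA).below_refl _))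
    ((key _).1 ((toBidistributive hA).below_refl _))

lemma Complemented.character_neg (hA : A ∈ varS) (h : A.Complemented) {e x : A.carrier}
    {f : A.carrier → Bool} (hf : (toBidistributive hA).IsCharacter e f)
    (hx : (toBidistributive hA).Below x e) (hx' : (toBidistributive hA).Below (A.neg x) e) :
    f (A.neg x) = !f x := by
  have h1 : (f x || f (A.neg x)) = true := by
    rw [← hf.map_join _ _ hx hx']
    change f (A.join x (A.neg x)) = true
    rw [h x]
    refine (hf.map_join _ _ ((toBidistributive hA).top_below e)
      ((toBidistributive hA).join_below_iff.2 ⟨hx, hx'⟩)).trans ?_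
    rw [hf.map_top, Bool.true_or]
  have h2 : (f (A.neg x) && f x) = false := by
    rw [← hf.map_meet _ _ hx' hx]
    change f (A.meet (A.neg x) x) = false
    have h3 := congrArg A.neg (h x)
    rw [neg_join hA, neg_join hA, neg_join hA, neg_neg_of_mem hA, neg_neg_of_mem hA] at h3
    rw [h3]
    refine (hf.map_meet _ _ ((toBidistributive hA).bot_below e)
      ((toBidistributive hA).meet_below_iff.2 ⟨hx', hx⟩)).trans ?_
    rw [hf.map_bot, Bool.false_and]
  revert h1 h2
  cases f x <;> cases f (A.neg x) <;> decide

/-- By `h4` both sides of the identity lie in the same fibre, which is enough if `A` is flat.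
Otherwise the characters of that fibre agree on both sides, by De Morgan validity or, if `A` is
complemented, because every character then comes from a Boolean valuation. -/
theorem satisfies_of_valid (hA : A ∈ varS) {p q : FreeMagma ℕ} (hw : word p = word q)
    (h4 : semilatticeFour.Satisfies p q ∨ A.NegBelow)
    (hB : boolTwo.Satisfies p q ∨ A.Flat)
    (hD : deMorganFour.Satisfies p q ∨ A.Complemented) : A.Satisfies p q := by
  classical
  intro v
  have he := eps_eval_eq hA hw h4 v
  rcases hB with hB | hR
  swap
  · rwa [hR.eps_eq hA, hR.eps_eq hA] at he
  refine (toBidistributive hA).eq_of_forall_isCharacter he fun f hf => ?_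
  have hq := (toBidistributive hA).below_of_eps_eq he.symm
  have hp := (toBidistributive hA).below_refl (A.eval v p)
  rcases hD with hD | hQ
  · have h1 := fun t => (character_eval hA hf (v := v) (w := fun i => (f (v i), f (A.neg (v i))))
      (fun _ _ => rfl) (fun _ _ => rfl) t).1
    rw [h1 p hp, h1 q hq, hD]
  · -- If only one of `x` and `x'` lies below the fibre, the other value is free, and chosen to
    -- make the valuation Boolean.
    let b : ℕ → Bool := fun i =>
      if (toBidistributive hA).Below (v i) (A.eval v p) then f (v i) else !f (A.neg (v i))
    have h1 := fun t => (character_eval hA hf (v := v) (w := fun i => (b i, !b i))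
      (fun i hi => by simp only [b, if_pos hi]) (fun i hi => by
        by_cases hv : (toBidistributive hA).Below (v i) (A.eval v p)
        · simp only [b, if_pos hv, hQ.character_neg hA hf hv hi]
        · simp only [b, if_neg hv, Bool.not_not]) t).1
    rw [h1 p hp, h1 q hq, eval_deMorganFour_bool, eval_deMorganFour_bool, hB]

/-- If `z'` is not below `z`, recording which of `x` and `x'` fail to lie below `z` is a surjective
homomorphism from `A` to `semilatticeFour`. -/
theorem negBelow_of_satisfies (hA : A ∈ varS) {p q : FreeMagma ℕ} (h : A.Satisfies p q)
    (h4 : ¬ semilatticeFour.Satisfies p q) : A.NegBelow := by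
  by_contra hP
  obtain ⟨z, hz⟩ := not_forall.1 hP
  have hz : ¬ (toBidistributive hA).Below (A.neg z) z := fun hb => hz (by
    rw [Bidistributive.Below, ← Bidistributive.join_eps] at hb
    exact hb)
  refine h4 fun w => ?_
  let v : ℕ → A.carrier := fun i =>
    match w i with
    | (false, false) => A.zero
    | (false, true) => z
    | (true, false) => A.neg z
    | (true, true) => A.join z (A.neg z)
  have hb := (toBidistributive hA).below_refl z
  have h0 := (toBidistributive hA).bot_below z
  have h1 := (toBidistributive hA).top_below z
  have hj := (toBidistributive hA).join_below_iff (x := z) (y := A.neg z) (w := z)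
  have hm := (toBidistributive hA).meet_below_iff (x := A.neg z) (y := z) (w := z)
  change (toBidistributive hA).Below (A.join z (A.neg z)) z ↔ _ at hj
  change (toBidistributive hA).Below (A.meet (A.neg z) z) z ↔ _ at hm
  change (toBidistributive hA).Below A.zero z at h0
  change (toBidistributive hA).Below (A.neg A.zero) z at h1
  have key := semilatticeFour_eval hA (e := z) (v := v) (w := w)
    (fun i => by
      rcases hw : w i with ⟨_ | _, _ | _⟩ <;> simp [v, *])
    (fun i => by
      rcases hw : w i with ⟨_ | _, _ | _⟩ <;>
        simp [v, neg_join hA, neg_neg_of_mem hA, *])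
  have e1 : ∀ a b : Bool, (a = false ↔ b = false) → a = b := by decide
  refine Prod.ext (e1 _ _ ?_) (e1 _ _ ?_)
  · rw [(key p).1, (key q).1, h v]
  · rw [(key p).2, (key q).2, h v]

/-- If `z ∨ z'` is not the greatest element of its fibre, some character vanishes at both `z` and
`z'`, so that `0`, `1` and `z` take the three values of the Kleene algebra there. -/
theorem complemented_of_satisfies (hA : A ∈ varS) {p q : FreeMagma ℕ} (h : A.Satisfies p q)
    (hK : ¬ KleeneValid p q) : A.Complemented := by
  by_contra hQ
  obtain ⟨z, hz⟩ := not_forall.1 hQ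
  let T := toBidistributive hA
  let e := A.join z (A.neg z)
  have hz' : T.join (T.eta e) e ≠ e := fun hc => hz (by
    rw [T.eta_join] at hc
    exact hc.symm)
  have he : T.eps (T.eta e) = T.eps e := T.eps_eta e
  obtain ⟨f, hf, hf1, hf0⟩ := T.exists_isCharacter_of_join_ne he rfl hz'
  have hbz : T.Below z e ∧ T.Below (A.neg z) e := T.join_below_iff.1 (T.below_refl e)
  have hfz : (f z || f (A.neg z)) = false := (hf.map_join _ _ hbz.1 hbz.2).symm.trans hf0
  rw [Bool.or_eq_false_iff] at hfz
  refine hK fun w hw => ?_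
  let v : ℕ → A.carrier := fun i =>
    match w i with
    | (false, true) => A.zero
    | (true, false) => A.neg A.zero
    | _ => z
  have h0 := hf.map_bot
  have h1 := hf.map_top
  change f A.zero = false at h0
  change f (A.neg A.zero) = true at h1
  have b0 := T.bot_below e
  have b1 := T.top_below e
  change T.Below A.zero e at b0
  change T.Below (A.neg A.zero) e at b1
  have key := character_eval hA hf (v := v) (w := w)
    (fun i _ => by
      have := hw i
      rcases hwi : w i with ⟨_ | _, _ | _⟩ <;> simp_all [v])
    (fun i _ => by
      have := hw i
      rcases hwi : w i with ⟨_ | _, _ | _⟩ <;> simp_all [v, neg_neg_of_mem hA])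
  have hb : ∀ t, T.Below (A.eval v t) e ∧ T.Below (A.neg (A.eval v t)) e := by
    refine eval_below hA fun i => ?_
    rcases hwi : w i with ⟨_ | _, _ | _⟩ <;> simp [v, neg_neg_of_mem hA, hwi, b0, b1, hbz.1, hbz.2, T]
  refine Prod.ext ?_ ?_
  · rw [← (key p).1 (hb p).1, ← (key q).1 (hb q).1, h v]
  · rw [← (key p).2 (hb p).2, ← (key q).2 (hb q).2, h v]

/-- If `0 ≠ 1`, then `0` and `1` form a subalgebra isomorphic to `boolTwo`. -/
theorem flat_of_satisfies (hA : A ∈ varS) {p q : FreeMagma ℕ} (h : A.Satisfies p q)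
    (hB : ¬ boolTwo.Satisfies p q) : A.Flat := by
  by_contra hR
  refine hB fun b => ?_
  let g : Bool → A.carrier := fun a => if a then A.neg A.zero else A.zero
  have hg : ∀ a c, A.imp (g a) (g c) = g (!a || c) := by
    have e1 : ∀ c, A.imp A.zero (g c) = A.neg A.zero := by
      rintro (_ | _)
      · rfl
      · rw [imp_eq_join hA]
        exact (toBidistributive hA).join_top_top
    have e2 : ∀ c, A.imp (A.neg A.zero) c = c := (toBidistributive hA).bot_join
    rintro (_ | _) c
    · exact e1 c
    · exact e2 _
  have key : ∀ t, A.eval (fun i => g (b i)) t = g (boolTwo.eval b t) := by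
    intro t
    induction t with
    | ih1 n => rfl
    | ih2 s t hs ht =>
      change A.imp (A.eval _ s) (A.eval _ t) = _
      rw [hs, ht, hg]
      rfl
  have hinj : ∀ a c, g a = g c → a = c := by
    rintro (_ | _) (_ | _) hac
    · rfl
    · exact absurd hac.symm hR
    · exact absurd hac hR
    · rfl
  exact hinj _ _ (by rw [← key, ← key, h])

/-! ### Bracketings of words of length at most four -/

lemma eval_of (A : Zroupoid.{u}) (v : ℕ → A.carrier) (n : ℕ) :
    A.eval v (FreeMagma.of n) = v n := rfl

lemma eval_mul (A : Zroupoid.{u}) (v : ℕ → A.carrier) (s t : FreeMagma ℕ) :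
    A.eval v (s * t) = A.imp (A.eval v s) (A.eval v t) := rfl

/-- The terms with a given word, for words of length at most four. -/
def bracketings : List ℕ → List (FreeMagma ℕ)
  | [a] => [.of a]
  | [a, b] => [.of a * .of b]
  | [a, b, c] => [.of a * (.of b * .of c), (.of a * .of b) * .of c]
  | [a, b, c, d] =>
    [.of a * (.of b * (.of c * .of d)), .of a * ((.of b * .of c) * .of d),
      (.of a * .of b) * (.of c * .of d), (.of a * (.of b * .of c)) * .of d,
      ((.of a * .of b) * .of c) * .of d]
  | _ => []

lemma word_mul (s t : FreeMagma ℕ) : word (s * t) = word s ++ word t := rfl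

lemma length_word (t : FreeMagma ℕ) : (word t).length = t.length := by
  induction t with
  | ih1 n => rfl
  | ih2 s t hs ht => rw [word_mul, List.length_append, hs, ht]; rfl

lemma exists_mul_of_one_lt_length {t : FreeMagma ℕ} (h : 1 < t.length) :
    ∃ s u, t = s * u ∧ t.length = s.length + u.length ∧ 0 < s.length ∧ 0 < u.length := by
  cases t with
  | of n => exact absurd h (lt_irrefl 1)
  | mul s u => exact ⟨s, u, rfl, rfl, s.length_pos, u.length_pos⟩

lemma exists_of_length_eq_one {t : FreeMagma ℕ} (h : t.length = 1) : ∃ a, t = .of a := by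
  cases t with
  | of n => exact ⟨n, rfl⟩
  | mul s u =>
    have h1 : s.length + u.length = 1 := h
    have := s.length_pos
    have := u.length_pos
    omega

lemma exists_of_length_eq_two {t : FreeMagma ℕ} (h : t.length = 2) :
    ∃ a b, t = .of a * .of b := by
  obtain ⟨s, u, rfl, hl, hs, hu⟩ := exists_mul_of_one_lt_length (t := t) (by omega)
  obtain ⟨a, rfl⟩ := exists_of_length_eq_one (t := s) (by omega)
  obtain ⟨b, rfl⟩ := exists_of_length_eq_one (t := u) (by omega)
  exact ⟨a, b, rfl⟩

lemma exists_of_length_eq_three {t : FreeMagma ℕ} (h : t.length = 3) :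
    ∃ a b c, t = .of a * (.of b * .of c) ∨ t = (.of a * .of b) * .of c := by
  obtain ⟨s, u, rfl, hl, hs, hu⟩ := exists_mul_of_one_lt_length (t := t) (by omega)
  obtain h1 | h1 : s.length = 1 ∨ s.length = 2 := by omega
  · obtain ⟨a, rfl⟩ := exists_of_length_eq_one h1
    obtain ⟨b, c, rfl⟩ := exists_of_length_eq_two (t := u) (by omega)
    exact ⟨a, b, c, .inl rfl⟩
  · obtain ⟨a, b, rfl⟩ := exists_of_length_eq_two h1
    obtain ⟨c, rfl⟩ := exists_of_length_eq_one (t := u) (by omega)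
    exact ⟨a, b, c, .inr rfl⟩

lemma mem_bracketings {t : FreeMagma ℕ} (h : t.length ≤ 4) : t ∈ bracketings (word t) := by
  have h0 := t.length_pos
  obtain h1 | h1 | h1 | h1 : t.length = 1 ∨ t.length = 2 ∨ t.length = 3 ∨ t.length = 4 := by omega
  · obtain ⟨a, rfl⟩ := exists_of_length_eq_one h1
    simp [word, bracketings]
  · obtain ⟨a, b, rfl⟩ := exists_of_length_eq_two h1
    simp [word, bracketings]
  · obtain ⟨a, b, c, rfl | rfl⟩ := exists_of_length_eq_three h1 <;>
      simp [word, bracketings]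
  · obtain ⟨s, u, rfl, hl, hs, hu⟩ := exists_mul_of_one_lt_length (t := t) (by omega)
    obtain h2 | h2 | h2 : s.length = 1 ∨ s.length = 2 ∨ s.length = 3 := by omega
    · obtain ⟨a, rfl⟩ := exists_of_length_eq_one h2
      obtain ⟨b, c, d, rfl | rfl⟩ := exists_of_length_eq_three (t := u) (by omega) <;>
        simp [word, bracketings]
    · obtain ⟨a, b, rfl⟩ := exists_of_length_eq_two h2
      obtain ⟨c, d, rfl⟩ := exists_of_length_eq_two (t := u) (by omega)
      simp [word, bracketings]
    · obtain ⟨d, rfl⟩ := exists_of_length_eq_one (t := u) (by omega)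
      obtain ⟨a, b, c, rfl | rfl⟩ := exists_of_length_eq_three h2 <;>
        simp [word, bracketings]

lemma word_of_mem_bracketings {w : List ℕ} {t : FreeMagma ℕ} (h : t ∈ bracketings w) :
    word t = w := by
  unfold bracketings at h
  split at h <;> simp only [List.mem_cons, List.not_mem_nil, or_false] at h
  · subst h; rfl
  · subst h; rfl
  · rcases h with rfl | rfl <;> rfl
  · rcases h with rfl | rfl | rfl | rfl | rfl <;> rfl

/-- The map `deMorganFour → deMorganFour` that replaces the fixed point `(c, c)` of `'` by `0`, and
the other fixed point by `(0, 0)`; its image is the three-element Kleene algebra. -/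
def kleeneMap (c : Bool) : Bool × Bool → Bool × Bool
  | (true, true) => (false, c)
  | (false, false) => (false, !c)
  | a => a

lemma kleeneMap_ne (c : Bool) (a : Bool × Bool) : kleeneMap c a ≠ (true, true) := by
  revert c a; decide

set_option maxRecDepth 10000 in
/-- For terms of length at most four, a De Morgan valuation that separates two bracketings still
separates them after one of the maps `kleeneMap`. -/
lemma KleeneValid.deMorganFour {p q : FreeMagma ℕ} {w : List ℕ} (hp : p ∈ bracketings w)
    (hq : q ∈ bracketings w) (h : KleeneValid p q) : deMorganFour.Satisfies p q := by
  intro v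
  have h1 := h (fun i => kleeneMap true (v i)) fun i => kleeneMap_ne _ _
  have h2 := h (fun i => kleeneMap false (v i)) fun i => kleeneMap_ne _ _
  unfold bracketings at hp hq
  split at hp <;> simp only [List.mem_cons, List.not_mem_nil, or_false] at hp hq
  · rw [hp, hq]
  · rw [hp, hq]
  · rename_i a b c
    revert h1 h2
    rcases hp with rfl | rfl <;> rcases hq with rfl | rfl <;> first | exact fun _ _ => rfl |
      (simp only [eval_mul, eval_of]
       generalize v a = a', v b = b', v c = c'
       revert a' b' c'
       decide +kernel)
  · rename_i a b c d
    revert h1 h2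
    rcases hp with rfl | rfl | rfl | rfl | rfl <;> rcases hq with rfl | rfl | rfl | rfl | rfl <;>
      first | exact fun _ _ => rfl |
      (simp only [eval_mul, eval_of]
       generalize v a = a', v b = b', v c = c', v d = d'
       revert a' b' c' d'
       decide +kernel)

/-! ### Counting the laws -/

instance : DecidablePred Alphabetical := fun w =>
  inferInstanceAs (Decidable (∀ (i : ℕ) (hi : i < w.length), ∀ k < w[i], k ∈ w.take i))

/-- The alphabetical words of lengths three and four. -/
def alphabeticalWords : Finset (List ℕ) :=
  ((Finset.range 2 ×ˢ Finset.range 3).image (fun t => [0, t.1, t.2]) ∪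
    (Finset.range 2 ×ˢ Finset.range 3 ×ˢ Finset.range 4).image
      (fun t => [0, t.1, t.2.1, t.2.2])).filter Alphabetical

lemma Alphabetical.getElem_le {w : List ℕ} (h : Alphabetical w) (i : ℕ) (hi : i < w.length) :
    w[i] ≤ i := by
  have h1 : Finset.range w[i] ⊆ (w.take i).toFinset := fun k hk =>
    List.mem_toFinset.2 (h i hi k (Finset.mem_range.1 hk))
  have h2 := (Finset.card_le_card h1).trans (List.toFinset_card_le _)
  rw [Finset.card_range] at h2
  exact h2.trans (List.length_take_le _ _)

lemma mem_alphabeticalWords {w : List ℕ} (h : Alphabetical w) (hl : w.length = 3 ∨ w.length = 4) :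
    w ∈ alphabeticalWords := by
  refine Finset.mem_filter.2 ⟨?_, h⟩
  have hle := h.getElem_le
  rcases hl with hl | hl
  · obtain ⟨a, b, c, rfl⟩ := List.length_eq_three.1 hl
    have h0 := hle 0 (by simp)
    have h1 := hle 1 (by simp)
    have h2 := hle 2 (by simp)
    simp at h0 h1 h2
    subst h0
    refine Finset.mem_union_left _ (Finset.mem_image.2 ⟨(b, c), ?_, rfl⟩)
    simp only [Finset.mem_product, Finset.mem_range]
    omega
  · obtain ⟨a, b, c, d, rfl⟩ : ∃ a b c d, w = [a, b, c, d] := by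
      match w, hl with
      | [a, b, c, d], _ => exact ⟨a, b, c, d, rfl⟩
    have h0 := hle 0 (by simp)
    have h1 := hle 1 (by simp)
    have h2 := hle 2 (by simp)
    have h3 := hle 3 (by simp)
    simp at h0 h1 h2 h3
    subst h0
    refine Finset.mem_union_right _ (Finset.mem_image.2 ⟨(b, c, d), ?_, rfl⟩)
    simp only [Finset.mem_product, Finset.mem_range]
    omega

lemma length_of_mem_alphabeticalWords {w : List ℕ} (h : w ∈ alphabeticalWords) :
    w.length ≤ 4 := by
  revert w; decide +kernel

/-- The nontrivial weak associative laws of length at most four, as a finite set. -/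
def weakLawsFinset : Finset (Sym2 (FreeMagma ℕ)) :=
  alphabeticalWords.biUnion fun w =>
    (bracketings w).toFinset.offDiag.image fun t => s(t.1, t.2)

lemma weakLaws_eq : weakLaws = (weakLawsFinset : Set (Sym2 (FreeMagma ℕ))) := by
  ext e
  simp only [weakLawsFinset, Finset.mem_coe, Finset.mem_biUnion, Finset.mem_image,
    Finset.mem_offDiag, List.mem_toFinset, Prod.exists]
  constructor
  · rintro ⟨p, q, rfl, ⟨n, hn, hp, hq, hw⟩, hne, ha⟩
    have hpm := mem_bracketings (hp.trans_le hn)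
    have hqm := mem_bracketings (hq.trans_le hn)
    rw [← hw] at hqm
    refine ⟨word p, mem_alphabeticalWords ha ?_, p, q, ⟨hpm, hqm, hne⟩, rfl⟩
    rw [length_word]
    by_contra hl
    have h0 := p.length_pos
    obtain h1 | h1 : p.length = 1 ∨ p.length = 2 := by omega
    · obtain ⟨a, rfl⟩ := exists_of_length_eq_one h1
      simp [word, bracketings] at hqm
      exact hne hqm.symm
    · obtain ⟨a, b, rfl⟩ := exists_of_length_eq_two h1
      simp [word, bracketings] at hqm
      exact hne hqm.symm
  · rintro ⟨w, hw, p, q, ⟨hp, hq, hne⟩, rfl⟩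
    have hwp := word_of_mem_bracketings hp
    have hwq := word_of_mem_bracketings hq
    refine ⟨p, q, rfl, ⟨w.length, length_of_mem_alphabeticalWords hw, ?_, ?_, hwp.trans hwq.symm⟩,
      hne, ?_⟩
    · rw [← hwp, length_word]
    · rw [← hwq, length_word]
    · rw [hwp]; exact (Finset.mem_filter.1 hw).2

lemma ncard_weakLaws : weakLaws.ncard = 155 := by
  rw [weakLaws_eq, Set.ncard_coe_finset]
  decide +kernel

/-! ### The six varieties -/

/-- A weak associative law of length at most four defines the conjunction of those of the properties
`NegBelow`, `Flat`, `Complemented` whose corresponding finite algebra violates the law. -/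
theorem mem_subvariety_iff {A : Zroupoid.{u}} {p q : FreeMagma ℕ} {w : List ℕ}
    (hp : p ∈ bracketings w) (hq : q ∈ bracketings w) :
    A ∈ subvariety p q ↔ A ∈ varS ∧ (semilatticeFour.Satisfies p q ∨ A.NegBelow) ∧
      (boolTwo.Satisfies p q ∨ A.Flat) ∧ (KleeneValid p q ∨ A.Complemented) := by
  constructor
  · rintro ⟨hA, h⟩
    exact ⟨hA, or_iff_not_imp_left.2 (negBelow_of_satisfies hA h),
      or_iff_not_imp_left.2 (flat_of_satisfies hA h),
      or_iff_not_imp_left.2 (complemented_of_satisfies hA h)⟩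
  · rintro ⟨hA, h4, hB, hK⟩
    exact ⟨hA, satisfies_of_valid hA
      ((word_of_mem_bracketings hp).trans (word_of_mem_bracketings hq).symm) h4 hB
      (hK.imp_left (KleeneValid.deMorganFour hp hq))⟩

lemma mem_var42A12_iff {A : Zroupoid.{u}} : A ∈ var42A12 ↔ A ∈ varS ∧ A.NegBelow := by
  have h4 : ¬ semilatticeFour.Satisfies (x * (x * (x * y))) (x * ((x * x) * y)) := fun h =>
    absurd (h fun n => if n = 0 then (true, false) else (false, false)) (by decide)
  have hK : KleeneValid (x * (x * (x * y))) (x * ((x * x) * y)) := fun w hw => by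
    have h0 := hw 0
    have h1 := hw 1
    simp only [eval_mul, eval_of]
    generalize w 0 = a, w 1 = b at h0 h1 ⊢
    revert a b; decide
  rw [var42A12, mem_subvariety_iff (w := [0, 0, 0, 1]) (by simp [bracketings])
    (by simp [bracketings])]
  simp [h4, hK, hK.boolTwo]

lemma mem_var43F25_iff {A : Zroupoid.{u}} : A ∈ var43F25 ↔ A ∈ varS ∧ A.Complemented := by
  have h4 : semilatticeFour.Satisfies (x * ((y * z) * z)) (((x * y) * z) * z) := fun w => by
    simp only [eval_mul, eval_of]
    generalize w 0 = a, w 1 = b, w 2 = c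
    revert a b c; decide
  have hB : boolTwo.Satisfies (x * ((y * z) * z)) (((x * y) * z) * z) := fun w => by
    simp only [eval_mul, eval_of]
    generalize w 0 = a, w 1 = b, w 2 = c
    revert a b c; decide
  have hK : ¬ KleeneValid (x * ((y * z) * z)) (((x * y) * z) * z) := fun h =>
    absurd (h (fun n => if n = 2 then (false, false) else (false, true))
      (fun i => by split <;> decide)) (by decide)
  rw [var43F25, mem_subvariety_iff (w := [0, 1, 2, 2]) (by simp [bracketings])
    (by simp [bracketings])]
  simp [h4, hB, hK]

lemma mem_var43A12_iff {A : Zroupoid.{u}} :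
    A ∈ var43A12 ↔ A ∈ varS ∧ A.NegBelow ∧ A.Complemented := by
  have h4 : ¬ semilatticeFour.Satisfies (x * (x * (y * z))) (x * ((x * y) * z)) := fun h =>
    absurd (h fun n => if n = 0 then (true, false) else (false, false)) (by decide)
  have hB : boolTwo.Satisfies (x * (x * (y * z))) (x * ((x * y) * z)) := fun w => by
    simp only [eval_mul, eval_of]
    generalize w 0 = a, w 1 = b, w 2 = c
    revert a b c; decide
  have hK : ¬ KleeneValid (x * (x * (y * z))) (x * ((x * y) * z)) := fun h =>
    absurd (h (fun n => if n = 0 then (false, false) else (false, true))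
      (fun i => by split <;> decide)) (by decide)
  rw [var43A12, mem_subvariety_iff (w := [0, 0, 1, 2]) (by simp [bracketings])
    (by simp [bracketings])]
  simp [h4, hB, hK]

lemma mem_var43A23_iff {A : Zroupoid.{u}} : A ∈ var43A23 ↔ A ∈ varS ∧ A.Flat := by
  have h4 : semilatticeFour.Satisfies (x * ((x * y) * z)) ((x * x) * (y * z)) := fun w => by
    simp only [eval_mul, eval_of]
    generalize w 0 = a, w 1 = b, w 2 = c
    revert a b c; decide
  have hB : ¬ boolTwo.Satisfies (x * ((x * y) * z)) ((x * x) * (y * z)) := fun h =>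
    absurd (h fun n => n == 1) (by decide)
  rw [var43A23, mem_subvariety_iff (w := [0, 0, 1, 2]) (by simp [bracketings])
    (by simp [bracketings])]
  simp only [h4, hB, true_or, true_and, false_or]
  exact ⟨fun h => ⟨h.1, h.2.1⟩, fun h => ⟨h.1, h.2, .inr (h.2.complemented h.1)⟩⟩

lemma mem_varSL_iff {A : Zroupoid.{u}} : A ∈ varSL ↔ A ∈ varS ∧ A.NegBelow ∧ A.Flat := by
  constructor
  · rintro ⟨hI, hn, hc⟩
    have hm : ∀ a b, A.meet a b = A.imp a b := fun a b => by rw [meet, hn, hn]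
    have hA : A ∈ varS := ⟨hI, fun a => by rw [hn, hn], fun a b => by rw [hm, hm, hc]⟩
    refine ⟨hA, fun a => ?_, hn _⟩
    rw [hn a]
    exact (toBidistributive hA).join_self _
  · rintro ⟨hA, hP, hR⟩
    have hn : ∀ a, A.neg a = a := fun a => by
      have h1 : ∀ b, A.join (A.neg b) b = b := fun b => by
        have h2 := hP.below hA b
        rw [Bidistributive.Below, hR.eps_eq hA, hR.eps_eq hA] at h2
        exact h2
      have h2 := h1 (A.neg a)
      rw [neg_neg_of_mem hA, join_comm_of_mem hA, h1] at h2
      exact h2.symm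
    exact ⟨hA.1, hn, fun a b => by
      rw [imp_eq_join hA, imp_eq_join hA, hn, hn, join_comm_of_mem hA]⟩

/-- The pattern of the finite algebras satisfying the law leaves six possibilities, because validity
in the Kleene algebra entails validity in `boolTwo`, and `Flat` entails `Complemented`. -/
theorem subvariety_mem_sixVarieties {p q : FreeMagma ℕ} {w : List ℕ}
    (hp : p ∈ bracketings w) (hq : q ∈ bracketings w) :
    subvariety.{u} p q ∈ sixVarieties := by
  have hex : ∀ V ∈ sixVarieties.{u}, (∀ A, A ∈ subvariety p q ↔ A ∈ V) →
      subvariety p q ∈ sixVarieties := fun V hV h => by rwa [Set.ext h]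
  have hR : ∀ {A : Zroupoid.{u}}, A ∈ varS → A.Flat → A.Complemented :=
    fun hA h => h.complemented hA
  by_cases h4 : semilatticeFour.Satisfies p q <;> by_cases hK : KleeneValid p q
  · refine hex varS (by simp [sixVarieties]) fun A => ?_
    simp [mem_subvariety_iff hp hq, h4, hK, hK.boolTwo]
  · by_cases hB : boolTwo.Satisfies p q
    · refine hex var43F25 (by simp [sixVarieties]) fun A => ?_
      simp [mem_subvariety_iff hp hq, mem_var43F25_iff, h4, hK, hB]
    · refine hex var43A23 (by simp [sixVarieties]) fun A => ?_
      simp only [mem_subvariety_iff hp hq, mem_var43A23_iff, h4, hK, hB, true_or, true_and,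
        false_or]
      exact and_congr_right fun hA => and_iff_left_of_imp (hR hA)
  · refine hex var42A12 (by simp [sixVarieties]) fun A => ?_
    simp [mem_subvariety_iff hp hq, mem_var42A12_iff, h4, hK, hK.boolTwo]
  · by_cases hB : boolTwo.Satisfies p q
    · refine hex var43A12 (by simp [sixVarieties]) fun A => ?_
      simp [mem_subvariety_iff hp hq, mem_var43A12_iff, h4, hK, hB]
    · refine hex varSL (by simp [sixVarieties]) fun A => ?_
      simp only [mem_subvariety_iff hp hq, mem_varSL_iff, h4, hK, hB, false_or]
      exact and_congr_right fun hA => and_congr_right fun _ => and_iff_left_of_imp (hR hA)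

lemma varSL_eq_subvariety : varSL.{u} = subvariety (x * (y * z)) ((x * y) * z) := by
  have h4 : ¬ semilatticeFour.Satisfies (x * (y * z)) ((x * y) * z) := fun h =>
    absurd (h fun n => if n = 0 then (true, false) else (false, false)) (by decide)
  have hB : ¬ boolTwo.Satisfies (x * (y * z)) ((x * y) * z) := fun h =>
    absurd (h fun _ => false) (by decide)
  ext A
  rw [mem_subvariety_iff (w := [0, 1, 2]) (by simp [bracketings]) (by simp [bracketings]),
    mem_varSL_iff]
  simp only [h4, hB, false_or]
  exact and_congr_right fun hA => and_congr_right fun _ =>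
    ⟨fun h => ⟨h, .inr (h.complemented hA)⟩, And.left⟩

/-- A nontrivial law that holds throughout `𝓢`. -/
lemma varS_eq_subvariety : varS.{u} = subvariety (x * (x * (x * x))) ((x * x) * (x * x)) := by
  have h4 : semilatticeFour.Satisfies (x * (x * (x * x))) ((x * x) * (x * x)) := fun w => by
    simp only [eval_mul, eval_of]
    generalize w 0 = a
    revert a; decide
  have hK : KleeneValid (x * (x * (x * x))) ((x * x) * (x * x)) := fun w hw => by
    have h0 := hw 0
    simp only [eval_mul, eval_of]
    generalize w 0 = a at h0 ⊢
    revert a; decide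
  ext A
  rw [mem_subvariety_iff (w := [0, 0, 0, 0]) (by simp [bracketings]) (by simp [bracketings])]
  simp [h4, hK, hK.boolTwo]

lemma mk_mem_weakLaws {p q : FreeMagma ℕ} {w : List ℕ} (hw : w ∈ alphabeticalWords)
    (hp : p ∈ bracketings w) (hq : q ∈ bracketings w) (hne : p ≠ q) : s(p, q) ∈ weakLaws := by
  rw [weakLaws_eq, weakLawsFinset, Finset.mem_coe, Finset.mem_biUnion]
  exact ⟨w, hw, Finset.mem_image.2 ⟨(p, q), by simp [hp, hq, hne], rfl⟩⟩

lemma exists_weakLaw_of_mem_sixVarieties {V : Set Zroupoid.{u}} (hV : V ∈ sixVarieties) :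
    ∃ p q : FreeMagma ℕ, s(p, q) ∈ weakLaws ∧ V = subvariety p q := by
  simp only [sixVarieties, Set.mem_insert_iff, Set.mem_singleton_iff] at hV
  rcases hV with rfl | rfl | rfl | rfl | rfl | rfl
  · exact ⟨_, _, mk_mem_weakLaws (w := [0, 1, 2]) (by decide +kernel) (by simp [bracketings])
      (by simp [bracketings]) (by decide), varSL_eq_subvariety⟩
  · exact ⟨_, _, mk_mem_weakLaws (w := [0, 0, 1, 2]) (by decide +kernel) (by simp [bracketings])
      (by simp [bracketings]) (by decide), rfl⟩
  · exact ⟨_, _, mk_mem_weakLaws (w := [0, 0, 1, 2]) (by decide +kernel) (by simp [bracketings])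
      (by simp [bracketings]) (by decide), rfl⟩
  · exact ⟨_, _, mk_mem_weakLaws (w := [0, 0, 0, 1]) (by decide +kernel) (by simp [bracketings])
      (by simp [bracketings]) (by decide), rfl⟩
  · exact ⟨_, _, mk_mem_weakLaws (w := [0, 1, 2, 2]) (by decide +kernel) (by simp [bracketings])
      (by simp [bracketings]) (by decide), rfl⟩
  · exact ⟨_, _, mk_mem_weakLaws (w := [0, 0, 0, 0]) (by decide +kernel) (by simp [bracketings])
      (by simp [bracketings]) (by decide), varS_eq_subvariety⟩

/-- The order in which the two sides of a law are represented does not matter. -/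
lemma exists_isWeakAssociativeLaw_of_mem {p q : FreeMagma ℕ} (h : s(p, q) ∈ weakLaws) :
    ∃ n ≤ 4, IsWeakAssociativeLaw n p q := by
  obtain ⟨p', q', he, ⟨n, hn, hp, hq, hw⟩, -, -⟩ := h
  rcases Sym2.eq_iff.1 he with ⟨rfl, rfl⟩ | ⟨rfl, rfl⟩
  · exact ⟨n, hn, hp, hq, hw⟩
  · exact ⟨n, hn, hq, hp, hw.symm⟩

lemma IsWeakAssociativeLaw.subvariety_mem {n : ℕ} (hn : n ≤ 4) {p q : FreeMagma ℕ}
    (h : IsWeakAssociativeLaw n p q) : subvariety.{u} p q ∈ sixVarieties := by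
  refine subvariety_mem_sixVarieties (mem_bracketings (h.1.trans_le hn)) ?_
  rw [h.2.2]
  exact mem_bracketings (h.2.1.trans_le hn)

/-! ### Boolean algebras and separating examples -/

/-- The Boolean axioms force `'` to be involutive and contraposition to hold, whence membership in
`𝓢`; moreover `0 ∧ x = 0`, so that there is only one fibre. -/
lemma varBA_subset : varBA.{u} ⊆ var43A12 := by
  rintro A ⟨⟨hI, habs⟩, hself⟩
  have h1 : ∀ a, A.imp (A.neg A.zero) a = a := fun a => by rw [← hself a, habs]
  have h2 : ∀ a b, A.neg (A.imp a b) = A.neg (A.imp a (A.neg (A.neg b))) := fun a b => by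
    have h := hI.1 a b A.zero
    rw [h1] at h
    exact h
  have h3 : ∀ a, A.neg (A.neg (A.neg a)) = A.neg a := fun a => by
    have h := h2 (A.neg A.zero) a
    rw [h1, h1] at h
    exact h.symm
  -- every element is a negation
  have h4 : ∀ a, A.neg (A.imp a (A.neg a)) = a := fun a => by
    have h := hI.1 a (A.neg a) a
    rw [habs, show A.imp (A.neg a) a = a from habs a A.zero] at h
    exact h.symm
  have hnn : ∀ a, A.neg (A.neg a) = a := fun a => by
    conv_lhs => rw [← h4 a]
    rw [h3, h4]
  have h0 : ∀ a, A.imp A.zero a = A.neg A.zero := fun a => by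
    rw [← hnn (A.imp A.zero a)]
    exact congrArg A.neg (habs A.zero a)
  have hcontra : ∀ a b, A.imp a b = A.imp (A.neg b) (A.neg a) := fun a b => by
    have h := hI.1 (A.neg a) A.zero b
    change A.imp (A.neg (A.neg a)) b = _ at h
    rw [hnn, h0, hnn] at h
    exact h.trans (hnn _)
  have hA : A ∈ varS := ⟨hI, hnn, fun a b => by
    rw [meet, meet, hcontra a, hnn]⟩
  have hE : ∀ a, A.meet A.zero a = A.zero := fun a => by rw [meet, h0, hnn]
  refine mem_var43A12_iff.2 ⟨hA, fun a => ?_, fun a => ?_⟩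
  · rw [hE, hE]
    exact (toBidistributive hA).join_self _
  · rw [show A.join a (A.neg a) = A.neg A.zero from hself _]
    exact ((toBidistributive hA).join_self _).symm

/-- A copy of a zroupoid in a higher universe. -/
def lift (A : Zroupoid.{0}) : Zroupoid.{u} where
  carrier := ULift A.carrier
  imp a b := ⟨A.imp a.down b.down⟩
  zero := ⟨A.zero⟩

lemma lift_mem_varS {A : Zroupoid.{0}} (h : A ∈ varS) : lift.{u} A ∈ varS :=
  ⟨⟨fun a b c => congrArg ULift.up (h.1.1 a.down b.down c.down), congrArg ULift.up h.1.2⟩,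
    fun a => congrArg ULift.up (h.2.1 a.down),
    fun a b => congrArg ULift.up (h.2.2 a.down b.down)⟩

lemma lift_negBelow {A : Zroupoid.{0}} : (lift.{u} A).NegBelow ↔ A.NegBelow :=
  ⟨fun h a => congrArg ULift.down (h ⟨a⟩), fun h a => congrArg ULift.up (h a.down)⟩

lemma lift_complemented {A : Zroupoid.{0}} : (lift.{u} A).Complemented ↔ A.Complemented :=
  ⟨fun h a => congrArg ULift.down (h ⟨a⟩), fun h a => congrArg ULift.up (h a.down)⟩

lemma lift_flat {A : Zroupoid.{0}} : (lift.{u} A).Flat ↔ A.Flat :=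
  ⟨fun h => congrArg ULift.down h, fun h => congrArg ULift.up h⟩

lemma boolTwo_mem_varS : boolTwo ∈ varS :=
  ⟨⟨by decide, by decide⟩, by decide, by decide⟩

lemma semilatticeTwo_mem_varS : semilatticeTwo ∈ varS :=
  ⟨⟨by decide, by decide⟩, by decide, by decide⟩

lemma deMorganFour_mem_varS : deMorganFour ∈ varS :=
  ⟨⟨by decide, by decide⟩, by decide, by decide⟩

lemma semilatticeFour_mem_varS : semilatticeFour ∈ varS :=
  ⟨⟨by decide, by decide⟩, by decide, by decide⟩

lemma boolTwo_negBelow : boolTwo.NegBelow := by unfold NegBelow; decide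

lemma boolTwo_complemented : boolTwo.Complemented := by unfold Complemented; decide

lemma boolTwo_not_flat : ¬ boolTwo.Flat := by unfold Flat; decide

lemma semilatticeTwo_negBelow : semilatticeTwo.NegBelow := by unfold NegBelow; decide

lemma semilatticeTwo_complemented : semilatticeTwo.Complemented := by unfold Complemented; decide

lemma deMorganFour_negBelow : deMorganFour.NegBelow := by unfold NegBelow; decide

lemma deMorganFour_not_complemented : ¬ deMorganFour.Complemented := by
  unfold Complemented; decide

lemma semilatticeFour_not_negBelow : ¬ semilatticeFour.NegBelow := by unfold NegBelow; decide

lemma semilatticeFour_complemented : semilatticeFour.Complemented := by unfold Complemented; decide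

lemma semilatticeFour_flat : semilatticeFour.Flat := by unfold Flat; decide

lemma lift_semilatticeTwo_notMem_varBA : lift.{u} semilatticeTwo ∉ varBA := fun h =>
  absurd (congrArg ULift.down (h.2 ⟨true⟩)) (by decide)

instance (A : Zroupoid.{0}) [h : Finite A.carrier] : Finite (lift.{u} A).carrier :=
  inferInstanceAs (Finite (ULift A.carrier))

lemma boolTwo_mem : lift.{u} boolTwo ∉ varSL ∧ lift.{u} boolTwo ∈ var43A12 ∧
    lift.{u} boolTwo ∉ var43A23 ∧ lift.{u} boolTwo ∈ var42A12 ∧ lift.{u} boolTwo ∈ var43F25 := by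
  simp [mem_varSL_iff, mem_var43A12_iff, mem_var43A23_iff, mem_var42A12_iff, mem_var43F25_iff,
    lift_mem_varS boolTwo_mem_varS, lift_negBelow, lift_complemented, lift_flat, boolTwo_negBelow,
    boolTwo_complemented, boolTwo_not_flat]

lemma deMorganFour_mem : lift.{u} deMorganFour ∉ var43A12 ∧ lift.{u} deMorganFour ∈ var42A12 ∧
    lift.{u} deMorganFour ∉ var43F25 := by
  simp [mem_var43A12_iff, mem_var42A12_iff, mem_var43F25_iff,
    lift_mem_varS deMorganFour_mem_varS, lift_negBelow, lift_complemented,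
    deMorganFour_negBelow, deMorganFour_not_complemented]

lemma semilatticeFour_mem : lift.{u} semilatticeFour ∉ varSL ∧
    lift.{u} semilatticeFour ∉ var43A12 ∧ lift.{u} semilatticeFour ∈ var43A23 ∧
    lift.{u} semilatticeFour ∉ var42A12 ∧ lift.{u} semilatticeFour ∈ var43F25 := by
  simp [mem_varSL_iff, mem_var43A12_iff, mem_var43A23_iff, mem_var42A12_iff, mem_var43F25_iff,
    lift_mem_varS semilatticeFour_mem_varS, lift_negBelow, lift_complemented, lift_flat,
    semilatticeFour_not_negBelow, semilatticeFour_complemented, semilatticeFour_flat]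

lemma lift_semilatticeTwo_mem : lift.{u} semilatticeTwo ∈ var43A12 :=
  mem_var43A12_iff.2 ⟨lift_mem_varS semilatticeTwo_mem_varS,
    lift_negBelow.2 semilatticeTwo_negBelow, lift_complemented.2 semilatticeTwo_complemented⟩

lemma varSL_subset_var43A12 : varSL.{u} ⊆ var43A12 := fun A h => by
  rw [mem_varSL_iff] at h
  exact mem_var43A12_iff.2 ⟨h.1, h.2.1, h.2.2.complemented h.1⟩

lemma varSL_subset_var43A23 : varSL.{u} ⊆ var43A23 := fun A h => by
  rw [mem_varSL_iff] at h
  exact mem_var43A23_iff.2 ⟨h.1, h.2.2⟩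

lemma var43A23_subset_var43F25 : var43A23.{u} ⊆ var43F25 := fun A h => by
  rw [mem_var43A23_iff] at h
  exact mem_var43F25_iff.2 ⟨h.1, h.2.complemented h.1⟩

lemma var43A12_subset_var42A12 : var43A12.{u} ⊆ var42A12 := fun A h => by
  rw [mem_var43A12_iff] at h
  exact mem_var42A12_iff.2 ⟨h.1, h.2.1⟩

lemma var43A12_subset_var43F25 : var43A12.{u} ⊆ var43F25 := fun A h => by
  rw [mem_var43A12_iff] at h
  exact mem_var43F25_iff.2 ⟨h.1, h.2.2⟩

lemma ncard_sixVarieties : (sixVarieties.{u}).ncard = 6 := by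
  have hne : ∀ {V W : Set Zroupoid.{u}} (A : Zroupoid.{u}), A ∈ V → A ∉ W → V ≠ W :=
    fun A hV hW h => hW (h ▸ hV)
  obtain ⟨b1, b2, b3, b4, b5⟩ := boolTwo_mem.{u}
  obtain ⟨d1, d2, d3⟩ := deMorganFour_mem.{u}
  obtain ⟨s1, s2, s3, s4, s5⟩ := semilatticeFour_mem.{u}
  have bS := lift_mem_varS.{u} boolTwo_mem_varS
  have dS := lift_mem_varS.{u} deMorganFour_mem_varS
  have sS := lift_mem_varS.{u} semilatticeFour_mem_varS
  rw [sixVarieties, Set.ncard_insert_of_notMem, Set.ncard_insert_of_notMem,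
    Set.ncard_insert_of_notMem, Set.ncard_insert_of_notMem, Set.ncard_insert_of_notMem,
    Set.ncard_singleton]
  all_goals simp only [Set.mem_insert_iff, Set.mem_singleton_iff, not_or]
  · exact (hne _ dS d3).symm
  · exact ⟨(hne _ s5 s4).symm, (hne _ sS s4).symm⟩
  · exact ⟨(hne _ b4 b3).symm, (hne _ b5 b3).symm, (hne _ bS b3).symm⟩
  · exact ⟨hne _ b2 b3, (hne _ d2 d1).symm, (hne _ s5 s2).symm, (hne _ sS s2).symm⟩
  · exact ⟨(hne _ b2 b1).symm, (hne _ s3 s1).symm, (hne _ b4 b1).symm, (hne _ b5 b1).symm,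
      (hne _ bS b1).symm⟩

end Zroupoid

theorem theorem8p2 :
    -- (a) the 155 laws, and the varieties that they define
    Zroupoid.weakLaws.ncard = 155 ∧
    {V : Set Zroupoid.{u} | ∃ p q : FreeMagma ℕ, s(p, q) ∈ Zroupoid.weakLaws ∧
        V = Zroupoid.subvariety p q} = Zroupoid.sixVarieties ∧
    {V : Set Zroupoid.{u} | ∃ n ≤ 4, ∃ p q : FreeMagma ℕ,
        Zroupoid.IsWeakAssociativeLaw n p q ∧
        V = Zroupoid.subvariety p q} = Zroupoid.sixVarieties ∧
    (Zroupoid.sixVarieties.{u}).ncard = 6 ∧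
    -- (b) the order relations; `⊂` is proper inclusion
    (Zroupoid.varSL.{u} ⊂ Zroupoid.var43A23 ∧
      Zroupoid.var43A23.{u} ⊂ Zroupoid.var43F25 ∧
      Zroupoid.var43F25.{u} ⊂ Zroupoid.varS) ∧
    (Zroupoid.varSL.{u} ⊂ Zroupoid.var43A12 ∧
      Zroupoid.var43A12.{u} ⊂ Zroupoid.var42A12 ∧
      Zroupoid.var42A12.{u} ⊂ Zroupoid.varS) ∧
    (Zroupoid.varBA.{u} ⊂ Zroupoid.var43A12 ∧
      Zroupoid.var43A12.{u} ⊂ Zroupoid.var43F25) ∧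
    -- the two incomparable pairs, each non-inclusion with a finite algebra witnessing it
    (¬ Zroupoid.var43A12.{u} ⊆ Zroupoid.var43A23 ∧
      ¬ Zroupoid.var43A23.{u} ⊆ Zroupoid.var43A12) ∧
    (¬ Zroupoid.var42A12.{u} ⊆ Zroupoid.var43F25 ∧
      ¬ Zroupoid.var43F25.{u} ⊆ Zroupoid.var42A12) ∧
    (∃ A : Zroupoid.{u}, Finite A.carrier ∧ A ∈ Zroupoid.var43A12 ∧ A ∉ Zroupoid.var43A23) ∧
    (∃ A : Zroupoid.{u}, Finite A.carrier ∧ A ∈ Zroupoid.var43A23 ∧ A ∉ Zroupoid.var43A12) ∧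
    (∃ A : Zroupoid.{u}, Finite A.carrier ∧ A ∈ Zroupoid.var42A12 ∧ A ∉ Zroupoid.var43F25) ∧
    (∃ A : Zroupoid.{u}, Finite A.carrier ∧ A ∈ Zroupoid.var43F25 ∧ A ∉ Zroupoid.var42A12) := by
  obtain ⟨b1, b2, b3, b4, b5⟩ := Zroupoid.boolTwo_mem.{u}
  obtain ⟨d1, d2, d3⟩ := Zroupoid.deMorganFour_mem.{u}
  obtain ⟨s1, s2, s3, s4, s5⟩ := Zroupoid.semilatticeFour_mem.{u}
  have dS := Zroupoid.lift_mem_varS.{u} Zroupoid.deMorganFour_mem_varS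
  have sS := Zroupoid.lift_mem_varS.{u} Zroupoid.semilatticeFour_mem_varS
  have hss : ∀ {V W : Set Zroupoid.{u}} (A : Zroupoid.{u}), V ⊆ W → A ∈ W → A ∉ V → V ⊂ W :=
    fun A h hW hV => ⟨h, fun h' => hV (h' hW)⟩
  have hns : ∀ {V W : Set Zroupoid.{u}} (A : Zroupoid.{u}), A ∈ V → A ∉ W → ¬ V ⊆ W :=
    fun A hV hW h => hW (h hV)
  refine ⟨Zroupoid.ncard_weakLaws, ?_, ?_, Zroupoid.ncard_sixVarieties,
    ⟨hss _ Zroupoid.varSL_subset_var43A23 s3 s1, hss _ Zroupoid.var43A23_subset_var43F25 b5 b3,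
      hss _ (fun _ h => h.1) dS d3⟩,
    ⟨hss _ Zroupoid.varSL_subset_var43A12 b2 b1, hss _ Zroupoid.var43A12_subset_var42A12 d2 d1,
      hss _ (fun _ h => h.1) sS s4⟩,
    ⟨hss _ Zroupoid.varBA_subset Zroupoid.lift_semilatticeTwo_mem
        Zroupoid.lift_semilatticeTwo_notMem_varBA,
      hss _ Zroupoid.var43A12_subset_var43F25 s5 s2⟩,
    ⟨hns _ b2 b3, hns _ s3 s2⟩, ⟨hns _ d2 d3, hns _ s5 s4⟩,
    ⟨_, inferInstance, b2, b3⟩, ⟨_, inferInstance, s3, s2⟩, ⟨_, inferInstance, d2, d3⟩,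
    ⟨_, inferInstance, s5, s4⟩⟩
  · ext V
    refine ⟨?_, Zroupoid.exists_weakLaw_of_mem_sixVarieties⟩
    rintro ⟨p, q, h, rfl⟩
    obtain ⟨n, hn, h⟩ := Zroupoid.exists_isWeakAssociativeLaw_of_mem h
    exact h.subvariety_mem hn
  · ext V
    constructor
    · rintro ⟨n, hn, p, q, h, rfl⟩
      exact h.subvariety_mem hn
    · intro hV
      obtain ⟨p, q, h, rfl⟩ := Zroupoid.exists_weakLaw_of_mem_sixVarieties hV
      obtain ⟨n, hn, h⟩ := Zroupoid.exists_isWeakAssociativeLaw_of_mem h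
      exact ⟨n, hn, p, q, h, rfl⟩
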